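/- For all integers $r \ge 1$ and $\ell \ge 2$ there is a number $N = N(r,\ell)$ such that for every $n \ge N$ and every coloring of the edges of the complete graph on $[n] = \{1, \ldots, n\}$ with $r$ colors, there are $2\ell$ pairwise distinct numbers $x_1, \ldots, x_\ell, y_1, \ldots, y_\ell \in [n]$ such that $$x_1 + \cdots + x_\ell = y_1 + \cdots + y_\ell$$ and the complete subgraph induced on the vertex set $\{x_1, \ldots, x_\ell, y_1, \ldots, y_\ell\}$ is monochromatic, i.e. all of its edges have the same color. -/

import Mathlib

/-- The set `S` of vertices induces a monochromatic subgraph under the colouring `χ` of the edges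
of the complete graph on `V`: one colour is carried by all edges with both endpoints in `S`. -/
def InducesMonochromatic {V K : Type*} (χ : SimpleGraph.TopEdgeLabeling V K) (S : Set V) : Prop :=
  ∃ κ : K, ∀ u ∈ S, ∀ v ∈ S, ∀ huv : u ≠ v, χ.get u v huv = κ

/-! It suffices to find a monochromatic `ℓ × ℓ` array of distinct numbers `α i + β a`: its diagonal
and its cyclically shifted diagonal are disjoint and have equal sums. Hales–Jewett and Ramsey,
iterated, give a tree of integers in which the colour of two leaves depends only on their branching
node and the increments only on level and letter. Some node `v` has, below each child, a node of its
own colour, all on one level. These nodes index the rows, their children the columns: two leaves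
branch at `v` or at a row node, and the common level makes the column offsets the same in every row.
-/

/-- The point of the integer tree with increments `E` that is reached along the word `w`. -/
def treePoint {β : Type*} : (ℕ → β → ℕ) → List β → ℕ
  | _, [] => 0
  | E, i :: w => E 0 i + treePoint (fun t => E (t + 1)) w

theorem treePoint_append {β : Type*} (u w : List β) (E : ℕ → β → ℕ) :
    treePoint E (u ++ w) = treePoint E u + treePoint (fun t => E (t + u.length)) w := by
  induction u generalizing E with
  | nil => simp [treePoint]
  | cons i u ih =>
    simp only [List.cons_append, treePoint, ih, List.length_cons, add_assoc]

theorem treePoint_smul {β : Type*} (w : List β) (s : ℕ) (E : ℕ → β → ℕ) :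
    treePoint (fun t i => s * E t i) w = s * treePoint E w := by
  induction w generalizing E with
  | nil => simp [treePoint]
  | cons i w ih => simp only [treePoint, mul_add, ← ih]

open Finset in
/-- In a long enough linear order, every colouring of the pairs admits a chain in which the colour
of a pair is determined by its smaller element. -/
theorem exists_endpoint_coloured_chain (K : Type*) [Finite K] (L : ℕ) :
    ∃ n : ℕ, ∀ (V : Type) [LinearOrder V] (f : V → V → K) (S : Finset V), n ≤ #S →
      ∃ (g : Fin L → V) (col : Fin L → K), StrictMono g ∧ (∀ i, g i ∈ S) ∧
        ∀ i j, i < j → f (g i) (g j) = col i := by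
  classical
  cases nonempty_fintype K
  induction L with
  | zero => exact ⟨0, fun V _ f S _ => ⟨Fin.elim0, Fin.elim0, fun i => i.elim0, fun i => i.elim0,
      fun i => i.elim0⟩⟩
  | succ L ih =>
    obtain ⟨n, hn⟩ := ih
    refine ⟨Fintype.card K * n + 1, fun V _ f S hS => ?_⟩
    have hne : S.Nonempty := card_pos.mp (by omega)
    set a := S.min' hne with ha
    have haS : a ∈ S := S.min'_mem hne
    have : Nonempty K := ⟨f a a⟩
    obtain ⟨c, -, hc⟩ := exists_le_card_fiber_of_mul_le_card_of_maps_to (s := S.erase a)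
      (t := univ) (f := f a) (n := n) (fun _ _ => mem_univ _) univ_nonempty
      (by rw [card_erase_of_mem haS, card_univ]; omega)
    obtain ⟨g, col, hg, hgS, hcol⟩ := hn V f _ hc
    have hlt : ∀ i, a < g i := fun i =>
      S.min'_lt_of_mem_erase_min' hne (mem_filter.mp (hgS i)).1
    refine ⟨Fin.cons a g, Fin.cons c col, ?_, ?_, ?_⟩
    · intro i j hij
      induction i using Fin.cases with
      | zero =>
        induction j using Fin.cases with
        | zero => exact absurd hij (lt_irrefl _)
        | succ j => simpa using hlt j
      | succ i =>
        induction j using Fin.cases with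
        | zero => exact absurd hij (Fin.not_lt_zero _)
        | succ j => simpa using hg (Fin.succ_lt_succ_iff.mp hij)
    · intro i
      induction i using Fin.cases with
      | zero => simpa using haS
      | succ i => simpa using mem_of_mem_erase (mem_filter.mp (hgS i)).1
    · intro i j hij
      induction j using Fin.cases with
      | zero => exact absurd hij (Fin.not_lt_zero _)
      | succ j =>
        induction i using Fin.cases with
        | zero => simpa using (mem_filter.mp (hgS j)).2
        | succ i => simpa using hcol i j (Fin.succ_lt_succ_iff.mp hij)

open Finset in
/-- **Ramsey's theorem** for pairs, with finitely many colours. -/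
theorem exists_monochromatic_chain (K : Type*) [Finite K] (k : ℕ) :
    ∃ n : ℕ, ∀ f : Fin n → Fin n → K, ∃ (g : Fin k → Fin n) (c : K), StrictMono g ∧
      ∀ i j, i < j → f (g i) (g j) = c := by
  classical
  cases nonempty_fintype K
  obtain ⟨n, hn⟩ := exists_endpoint_coloured_chain K (Fintype.card K * k + 1)
  refine ⟨n, fun f => ?_⟩
  obtain ⟨g, col, hg, -, hcol⟩ := hn (Fin n) f univ (by simp)
  have : Nonempty K := ⟨col 0⟩
  obtain ⟨c, -, hc⟩ := exists_le_card_fiber_of_mul_le_card_of_maps_to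
    (s := (univ : Finset (Fin (Fintype.card K * k + 1)))) (t := univ) (f := col) (n := k)
    (fun _ _ => mem_univ _) univ_nonempty (by simp)
  obtain ⟨T, hT, hTk⟩ := exists_subset_card_eq hc
  refine ⟨fun i => g (T.orderEmbOfFin hTk i), c, hg.comp (T.orderEmbOfFin hTk).strictMono,
    fun i j hij => ?_⟩
  rw [hcol _ _ ((T.orderEmbOfFin hTk).strictMono hij)]
  exact (mem_filter.mp (hT (T.orderEmbOfFin_mem hTk i))).2

open Finset in
/-- For every finite colouring of the pairs of a long interval there are `k` disjoint homothetic
copies of `[0, M)`, with a common ratio, such that all pairs across two copies have one colour. -/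
theorem exists_monochromatic_multipartite (K : Type*) [Finite K] (k M : ℕ) :
    ∃ n : ℕ, ∀ χ : ℕ → ℕ → K, ∃ (a : Fin k → ℕ) (s : ℕ) (c : K),
      0 < s ∧ (∀ i, ∀ p < M, a i + s * p < n) ∧
      ∀ i j, i < j → ∀ p < M, ∀ q < M,
        a i + s * p ≠ a j + s * q ∧ χ (a i + s * p) (a j + s * q) = c := by
  classical
  obtain ⟨m, hm⟩ := exists_monochromatic_chain K k
  -- A letter carries one coordinate for each of `m` blocks, so along a line the blocks move
  -- independently; constancy of the colour matrix then fixes the colour between any two blocks.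
  obtain ⟨ι, _, hι⟩ := Combinatorics.Line.exists_mono_in_high_dimension (Fin m → Fin M)
    (Fin m → Fin m → K)
  set B := Fintype.card ι * M + 1 with hB
  refine ⟨m * B, fun χ => ?_⟩
  let v : (ι → Fin m → Fin M) → Fin m → ℕ := fun w i => i * B + ∑ t, (w t i : ℕ)
  have hv : ∀ w (i : Fin m), (i : ℕ) * B ≤ v w i ∧ v w i < (i + 1) * B := by
    intro w i
    have : ∑ t, (w t i : ℕ) ≤ Fintype.card ι * M := by
      simpa using sum_le_card_nsmul univ (fun t => (w t i : ℕ)) M fun t _ => (w t i).2.le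
    exact ⟨Nat.le_add_right _ _, by simp only [v, add_mul]; omega⟩
  obtain ⟨l, C, hl⟩ := hι fun w i j => χ (v w i) (v w j)
  obtain ⟨g, c, hg, hc⟩ := hm C
  let s := #{t | l.idxFun t = none}
  let b : Fin m → ℕ := fun i => i * B + ∑ t, ((l.idxFun t).elim 0 fun y => (y i : ℕ))
  have hb : ∀ x i, v (l x) i = b i + s * x i := by
    intro x i
    simp only [v, b, s, add_assoc, card_filter, sum_mul, ← sum_add_distrib]
    congr 1
    refine sum_congr rfl fun t _ => ?_
    cases h : l.idxFun t <;> simp [h]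
  have hline : ∀ i j, i ≠ j → ∀ p < M, ∀ q < M, ∃ x,
      v (l x) i = b i + s * p ∧ v (l x) j = b j + s * q := by
    intro i j hij p hp q hq
    refine ⟨fun t => if t = i then ⟨p, hp⟩ else ⟨q, hq⟩, ?_, ?_⟩
    · simp [hb]
    · simp [hb, hij.symm]
  have hs : 0 < s := card_pos.mpr
    ⟨l.proper.choose, mem_filter.mpr ⟨mem_univ _, l.proper.choose_spec⟩⟩
  refine ⟨fun i => b (g i), s, c, hs, fun i p hp => ?_, fun i j hij p hp q hq => ?_⟩
  · have h1 := hb (fun _ => ⟨p, hp⟩) (g i)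
    simp only at h1 ⊢
    rw [← h1]
    exact (hv _ _).2.trans_le (Nat.mul_le_mul_right _ (g i).2)
  · obtain ⟨x, hx, hy⟩ := hline (g i) (g j) (hg hij).ne p hp q hq
    simp only
    rw [← hx, ← hy]
    have hgij : (g i : ℕ) + 1 ≤ g j := hg hij
    refine ⟨((hv (l x) (g i)).2.trans_le ((Nat.mul_le_mul_right B hgij).trans
      (hv (l x) (g j)).1)).ne, ?_⟩
    rw [← hc i j hij, ← hl x]

/-- Every finite colouring of the pairs of a long interval contains the leaves of a `k`-ary tree of
height `m` such that the colour of a pair of leaves only depends on their branching node. -/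
theorem exists_tree_coloured_by_meet (k m : ℕ) : ∀ (K : Type) [Finite K],
    ∃ n : ℕ, ∀ χ : ℕ → ℕ → K, ∃ (E : ℕ → Fin k → ℕ) (c : List (Fin k) → K),
      (∀ w : List (Fin k), w.length = m → treePoint E w < n) ∧
      ∀ (u v w : List (Fin k)) (i j : Fin k), i < j →
        (u ++ i :: v).length = m → (u ++ j :: w).length = m →
        treePoint E (u ++ i :: v) ≠ treePoint E (u ++ j :: w) ∧
        χ (treePoint E (u ++ i :: v)) (treePoint E (u ++ j :: w)) = c u := by
  induction m with
  | zero =>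
    intro K _
    refine ⟨1, fun χ => ⟨fun _ _ => 0, fun _ => χ 0 0, fun w hw => ?_, fun u v w i j _ h => ?_⟩⟩
    · rw [List.length_eq_zero_iff.mp hw]
      exact Nat.one_pos
    · simp at h
  | succ m ih =>
    intro K _
    obtain ⟨M, hM⟩ := ih (Fin k → K)
    obtain ⟨n, hn⟩ := exists_monochromatic_multipartite K k M
    refine ⟨n, fun χ => ?_⟩
    obtain ⟨a, s, c₀, hs, ha, hc₀⟩ := hn χ
    -- Colouring a pair of offsets by its colours in all `k` copies at once lets one subtree serve
    -- every copy.
    obtain ⟨E, c, hE, hc⟩ := hM fun p q i => χ (a i + s * p) (a i + s * q)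
    let E' : ℕ → Fin k → ℕ
      | 0 => a
      | t + 1 => fun i => s * E t i
    have hE' : ∀ i w, treePoint E' (i :: w) = a i + s * treePoint E w := fun i w => by
      rw [← treePoint_smul]
      rfl
    let c' : List (Fin k) → K
      | [] => c₀
      | i :: u => c u i
    refine ⟨E', c', fun w hw => ?_, fun u v w i j hij hv hw => ?_⟩
    · match w with
      | i :: w =>
        rw [hE']
        exact ha i _ (hE w (by simpa using hw))
    · match u with
      | [] =>
        simp only [List.nil_append, hE']
        exact hc₀ i j hij _ (hE v (by simpa using hv)) _ (hE w (by simpa using hw))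
      | e :: u =>
        simp only [List.cons_append, List.length_cons, Nat.add_right_cancel_iff] at hv hw
        obtain ⟨hne, hχ⟩ := hc u v w i j hij hv hw
        simp only [List.cons_append, hE']
        exact ⟨fun h => hne (Nat.eq_of_mul_eq_mul_left hs (Nat.add_left_cancel h)),
          congrFun hχ e⟩

open Finset in
/-- In a finitely coloured `k`-ary tree, some node has below each of its children a node of its own
colour, with these `k` nodes on a common level, which may be sought in any large set of levels. -/
theorem exists_monochromatic_star (k : ℕ) [NeZero k] (s : ℕ) :
    ∃ N : ℕ, ∀ {K : Type} (c : List (Fin k) → K) (C : Finset K) (J : Finset ℕ) (u : List (Fin k)),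
      #C ≤ s → N ≤ #J → (∀ j ∈ J, u.length ≤ j) →
      (∀ w : List (Fin k), (u ++ w).length ∈ J → c (u ++ w) ∈ C) →
      ∃ v : List (Fin k), ∃ j ∈ J, ∃ w : Fin k → List (Fin k),
        ∀ i, (v ++ i :: w i).length = j ∧ c (v ++ i :: w i) = c v := by
  classical
  induction s with
  | zero =>
    refine ⟨1, fun c C J u hC hJ hu hc => ?_⟩
    obtain ⟨j, hj⟩ := card_pos.mp hJ
    have := hc (List.replicate (j - u.length) 0) (by simpa [hu j hj] using hj)
    simp [card_eq_zero.mp (Nat.le_zero.mp hC)] at this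
  | succ s ih =>
    obtain ⟨N, hN⟩ := ih
    refine ⟨k * N + 1, fun c C J u hC hJ hu hc => ?_⟩
    have hne : J.Nonempty := card_pos.mp (by omega)
    set j₀ := J.min' hne with hj₀
    have hj₀J : j₀ ∈ J := J.min'_mem hne
    set v := u ++ List.replicate (j₀ - u.length) 0 with hv
    have hvlen : v.length = j₀ := by simp [hv, hu j₀ hj₀J]
    have hvC : c v ∈ C := hc _ (by rwa [← hv, hvlen])
    by_contra! hcon
    have hbad : ∀ j ∈ J, ∃ i, ∀ w : List (Fin k), (v ++ i :: w).length = j →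
        c (v ++ i :: w) ≠ c v := by
      intro j hj
      by_contra! h
      choose w hw using h
      obtain ⟨i, hi⟩ := hcon v j hj w
      exact hi (hw i).1 (hw i).2
    choose! e he using hbad
    -- Many levels share a bad child `i`; below it, on those levels, the colour of `v` is absent, so
    -- one colour fewer remains.
    obtain ⟨i, -, hi⟩ := exists_le_card_fiber_of_mul_le_card_of_maps_to (s := J.erase j₀)
      (t := univ) (f := e) (n := N) (fun _ _ => mem_univ _) univ_nonempty
      (by rw [card_erase_of_mem hj₀J, card_univ, Fintype.card_fin]; omega)
    have hsub : ∀ j ∈ {j ∈ J.erase j₀ | e j = i}, j ∈ J ∧ j₀ < j ∧ e j = i := fun j hj => by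
      rw [mem_filter] at hj
      exact ⟨mem_of_mem_erase hj.1, J.min'_lt_of_mem_erase_min' hne hj.1, hj.2⟩
    obtain ⟨v', j, hj, w, hw⟩ := hN c (C.erase (c v)) _ (v ++ [i])
      (by rw [card_erase_of_mem hvC]; omega) hi
      (fun j hj => by simpa [hvlen] using (hsub j hj).2.1)
      (fun w hw => by
        obtain ⟨h1, -, h3⟩ := hsub _ hw
        rw [mem_erase]
        refine ⟨?_, ?_⟩
        · have := he _ h1 w
          rw [h3] at this
          simpa using this
        · rw [hv] at h1 ⊢
          simp only [List.append_assoc] at h1 ⊢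
          exact hc _ h1)
    obtain ⟨i', hi'⟩ := hcon v' j (hsub j hj).1 w
    exact hi' (hw i').1 (hw i').2

/-- For every finite symmetric colouring of the pairs of a long interval there is a `k × k` array of
distinct points, each the sum of a row constant and a column constant, whose pairs all have one
colour. -/
theorem exists_monochromatic_array (k : ℕ) [NeZero k] (K : Type) [Finite K] :
    ∃ n : ℕ, ∀ χ : ℕ → ℕ → K, (∀ a b, χ a b = χ b a) →
      ∃ (p : Fin k → Fin k → ℕ) (α β : Fin k → ℕ) (c : K),
        (∀ i a, p i a < n) ∧ (∀ i a, p i a = α i + β a) ∧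
        ∀ i a j b, (i, a) ≠ (j, b) → p i a ≠ p j b ∧ χ (p i a) (p j b) = c := by
  classical
  cases nonempty_fintype K
  obtain ⟨m, hm⟩ := exists_monochromatic_star k (Fintype.card K)
  obtain ⟨n, hn⟩ := exists_tree_coloured_by_meet k m K
  refine ⟨n, fun χ hχ => ?_⟩
  obtain ⟨E, c, hE, hc⟩ := hn χ
  obtain ⟨v, j, hj, w, hw⟩ := hm c Finset.univ (Finset.range m) [] (by simp) (by simp) (by simp)
    (by simp)
  rw [Finset.mem_range] at hj
  let z : List (Fin k) := List.replicate (m - 1 - j) 0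
  let q : Fin k → Fin k → List (Fin k) := fun i a => (v ++ i :: w i) ++ a :: z
  have hq : ∀ i a, (q i a).length = m := fun i a => by
    rw [List.length_append, (hw i).1]
    simp only [List.length_cons, List.length_replicate, z]
    omega
  have hlt : ∀ i a j b, i < j ∨ i = j ∧ a < b →
      treePoint E (q i a) ≠ treePoint E (q j b) ∧
        χ (treePoint E (q i a)) (treePoint E (q j b)) = c v := by
    rintro i a j b (hij | ⟨rfl, hab⟩)
    · have hqv : ∀ i a, q i a = v ++ i :: (w i ++ a :: z) := fun i a => by simp [q]
      have h := hc v (w i ++ a :: z) (w j ++ b :: z) i j hij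
      rw [← hqv, ← hqv] at h
      exact h (hq i a) (hq j b)
    · have h := hc (v ++ i :: w i) z z a b hab (hq i a) (hq i b)
      rwa [(hw i).2] at h
  refine ⟨fun i a => treePoint E (q i a), fun i => treePoint E (v ++ i :: w i),
    fun a => treePoint (fun t => E (t + j)) (a :: z), c v, fun i a => hE _ (hq i a),
    fun i a => ?_, fun i a j b hne => ?_⟩
  · simp only [q]
    rw [treePoint_append, (hw i).1]
  · have : (i < j ∨ i = j ∧ a < b) ∨ (j < i ∨ j = i ∧ b < a) := by
      rcases lt_trichotomy i j with h | rfl | h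
      · exact .inl (.inl h)
      · rcases lt_trichotomy a b with h | rfl | h
        · exact .inl (.inr ⟨rfl, h⟩)
        · exact absurd rfl hne
        · exact .inr (.inr ⟨rfl, h⟩)
      · exact .inr (.inl h)
    rcases this with h | h
    · exact hlt i a j b h
    · obtain ⟨h1, h2⟩ := hlt j b i a h
      exact ⟨h1.symm, (hχ _ _).trans h2⟩

theorem mainTheorem4 (r ℓ : ℕ) (hℓ : 2 ≤ ℓ) :
    ∃ N : ℕ, ∀ n : ℕ, N ≤ n →
      ∀ χ : SimpleGraph.TopEdgeLabeling (Set.Icc 1 n) (Fin r),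
        ∃ x y : Fin ℓ → Set.Icc 1 n,
          Function.Injective (Sum.elim x y) ∧
          ∑ i, (x i : ℕ) = ∑ i, (y i : ℕ) ∧
          InducesMonochromatic χ (Set.range x ∪ Set.range y) := by
  classical
  have : NeZero ℓ := ⟨by omega⟩
  obtain ⟨M, hM⟩ := exists_monochromatic_array ℓ (Fin r)
  refine ⟨max M 2, fun n hn χ => ?_⟩
  have hMn : M ≤ n := (le_max_left _ _).trans hn
  have h2n : 2 ≤ n := (le_max_right _ _).trans hn
  -- Junk value, read off an edge because `Fin r` may be empty; hence the bound `2 ≤ n`.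
  let κ₀ : Fin r := χ.get ⟨1, by simp; omega⟩ ⟨2, by simp; omega⟩ (by simp)
  let χ' : ℕ → ℕ → Fin r := fun a b =>
    if h : a < n ∧ b < n ∧ a ≠ b then
      χ.get ⟨a + 1, by simp; omega⟩ ⟨b + 1, by simp; omega⟩ (by simpa using h.2.2)
    else κ₀
  have hsymm : ∀ a b, χ' a b = χ' b a := by
    intro a b
    by_cases h : a < n ∧ b < n ∧ a ≠ b
    · have h' : b < n ∧ a < n ∧ b ≠ a := ⟨h.2.1, h.1, h.2.2.symm⟩
      simp only [χ', dif_pos h, dif_pos h']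
      exact SimpleGraph.EdgeLabeling.get_comm _ _ _
    · have h' : ¬ (b < n ∧ a < n ∧ b ≠ a) := fun h' => h ⟨h'.2.1, h'.1, h'.2.2.symm⟩
      simp only [χ', dif_neg h, dif_neg h']
  obtain ⟨p, α, β, c, hlt, hadd, hp⟩ := hM χ' hsymm
  let P : Fin ℓ → Fin ℓ → Set.Icc 1 n := fun i a =>
    ⟨p i a + 1, by have := hlt i a; simp; omega⟩
  have hP : ∀ i a j b, P i a = P j b → i = j ∧ a = b := by
    intro i a j b h
    by_contra hne
    refine (hp i a j b fun h' => hne (Prod.mk.inj h')).1 ?_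
    simpa [P] using h
  have hone : ∀ i : Fin ℓ, i + 1 ≠ i := by
    intro i h
    have h1 : ((1 : Fin ℓ) : ℕ) = 0 := by rw [add_eq_left.mp h]; simp
    rw [Fin.val_one', Nat.mod_eq_of_lt (by omega)] at h1
    omega
  refine ⟨fun i => P i i, fun i => P i (i + 1), ?_, ?_, c, ?_⟩
  · rintro (i | i) (j | j) h
    · rw [(hP _ _ _ _ h).1]
    · obtain ⟨rfl, h'⟩ := hP _ _ _ _ h
      exact absurd h'.symm (hone _)
    · obtain ⟨rfl, h'⟩ := hP _ _ _ _ h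
      exact absurd h' (hone _)
    · rw [(hP _ _ _ _ h).1]
  · simp only [P, hadd, Finset.sum_add_distrib]
    -- The shift only permutes the column constants.
    rw [← Equiv.sum_comp (Equiv.addRight (1 : Fin ℓ)) β]
    rfl
  · have hrange : ∀ u ∈ Set.range (fun i => P i i) ∪ Set.range (fun i => P i (i + 1)),
        ∃ i a, P i a = u := by
      rintro u (⟨i, rfl⟩ | ⟨i, rfl⟩)
      exacts [⟨_, _, rfl⟩, ⟨_, _, rfl⟩]
    intro u hu v hv huv
    obtain ⟨i, a, rfl⟩ := hrange u hu
    obtain ⟨j, b, rfl⟩ := hrange v hv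
    obtain ⟨hne, hcol⟩ := hp i a j b (by rintro h; cases h; exact huv rfl)
    rw [← hcol]
    simp only [χ']
    rw [dif_pos ⟨(hlt i a).trans_le hMn, (hlt j b).trans_le hMn, hne⟩]
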